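/- Let $X$ be a complex Banach space with open unit ball $B$. Let $H^\infty(B)$ be the Banach algebra of bounded holomorphic functions on $B$ with the supremum norm, let $A_u(B)\subset H^\infty(B)$ be the subalgebra of uniformly continuous functions, and let $H(B)$ be a uniform algebra with $A_u(B)\subset H(B)\subset H^\infty(B)$, i.e. a norm-closed subalgebra of $H^\infty(B)$ containing $A_u(B)$. Let $M_{H(B)}$ be its spectrum (the nonzero multiplicative linear functionals on $H(B)$) and, for $f\in H(B)$, let $\hat f:M_{H(B)}\to\mathbb C$, $\hat f(\varphi)=\varphi(f)$, be the Gelfand transform. Every continuous polynomial $P=\sum_{k\le d}P_k$ on $X$, where $P_k(x)=A_k(x,\dots,x)$ with $A_k$ continuous, symmetric and $k$-linear, has an Aron–Berner extension $\tilde P(z)=\sum_{k\le d}\tilde A_k(z,\dots,z)$ to the bidual $X^{**}$; here $\tilde A_k$ is the Arens extension of $A_k$, obtained by extending one variable at a time by weak-star continuity. For $g\in A_u(B)$ with Taylor series $g=\sum_m P_m$ at $0$, put $\tilde g=\sum_m\tilde P_m$ on the open unit ball of $X^{**}$, and extend $\tilde g$ by norm continuity to the closed unit ball $\bar B^{**}$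 of $X^{**}$. Fix $x^{**}\in\bar B^{**}$. The polynomial fiber over $x^{**}$ is $$M^{\mathcal P}_{x^{**}}=\{\varphi\in M_{H(B)}:\ \varphi(g)=\tilde g(x^{**})\ \text{ for all } g\in A_u(B)\},$$ and the polynomial cluster set of $f\in H(B)$ at $x^{**}$ is the set $Cl^{\mathcal P}_B(f,x^{**})$ of all $\lambda\in\mathbb C$ for which there is a net $(x_\alpha)\subset B$ with $P(x_\alpha)\to\tilde P(x^{**})$ for every continuous polynomial $P$ on $X$ and $f(x_\alpha)\to\lambda$. One says that there is a polynomial cluster value theorem for $H(B)$ at $x^{**}$ if $Cl^{\mathcal P}_B(f,x^{**})=\hat f(M^{\mathcal P}_{x^{**}})$ for all $f\in H(B)$. **Theorem.** There is a polynomial cluster value theorem for $H(B)$ at $x^{**}$ if and only if, for every $n\ge 1$ and all $f_1,\dots,f_{n-1}\in A_u(B)$ and $f_n\in H(B)$ for which there is $\delta>0$ with $|f_1(x)|+\cdots+|f_n(x)|\ge\delta$ for all $x\in B$, the Gelfand transforms $\hat f_1,\dots,\hat f_n$ have no common zero in $M^{\mathcal P}_{x^{**}}$. -/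

import Mathlib

open Metric Set Filter Topology
open scoped BoundedContinuousFunction

noncomputable section

namespace PolyCluster

universe u

variable (X : Type u) [NormedAddCommGroup X] [NormedSpace ℂ X]

/-- The bidual `X**` of a complex normed space. -/
abbrev Bidual : Type u := StrongDual ℂ (StrongDual ℂ X)

/-- The Banach algebra of bounded continuous functions on the open unit ball `B` of `X`, with the
supremum norm; all function algebras below are subalgebras of it. -/
abbrev BallFun : Type u := ball (0 : X) 1 →ᵇ ℂ

variable {X}

/-- Extension of a function on the open unit ball to `X` by zero. Only its values on the open unit
ball matter below. -/
def zeroExt (f : ball (0 : X) 1 → ℂ) : X → ℂ := Function.extend Subtype.val f 0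

theorem zeroExt_apply (f : ball (0 : X) 1 → ℂ) {x : X} (hx : x ∈ ball (0 : X) 1) :
    zeroExt f x = f ⟨x, hx⟩ :=
  Subtype.val_injective.extend_apply f 0 (⟨x, hx⟩ : ball (0 : X) 1)

/-- `f` is holomorphic on the open unit ball: near every point of the ball it is the sum of a
convergent power series of continuous homogeneous polynomials. -/
def IsHolo (f : ball (0 : X) 1 → ℂ) : Prop := AnalyticOnNhd ℂ (zeroExt f) (ball (0 : X) 1)

theorem IsHolo.congr {f : ball (0 : X) 1 → ℂ} {F : X → ℂ} (hF : AnalyticOnNhd ℂ F (ball (0 : X) 1))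
    (h : ∀ x : ball (0 : X) 1, F x = f x) : IsHolo f :=
  AnalyticOnNhd.congr isOpen_ball hF fun x hx => by
    rw [zeroExt_apply f hx]; exact h ⟨x, hx⟩

variable (X)

/-- `H^∞(B)`: the bounded holomorphic functions on the open unit ball. -/
def HInf : Subalgebra ℂ (BallFun X) where
  carrier := {f | IsHolo f}
  mul_mem' {f g} hf hg := IsHolo.congr (AnalyticOnNhd.mul hf hg) fun x => by
    simp [zeroExt_apply _ x.2]
  add_mem' {f g} hf hg := IsHolo.congr (AnalyticOnNhd.add hf hg) fun x => by
    simp [zeroExt_apply _ x.2]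
  algebraMap_mem' c := IsHolo.congr (F := fun _ => c) analyticOnNhd_const fun x => by
    simp

/-- The bounded uniformly continuous functions on the open unit ball. -/
def BUC : Subalgebra ℂ (BallFun X) where
  carrier := {f | UniformContinuous f}
  mul_mem' {f g} hf hg := by
    rw [mem_ofPred_eq, Metric.uniformContinuous_iff] at *
    intro ε hε
    have hC : 0 < ‖f‖ + ‖g‖ + 1 := by positivity
    obtain ⟨a, ha, hfa⟩ := hf (ε / (‖f‖ + ‖g‖ + 1)) (by positivity)
    obtain ⟨b, hb, hgb⟩ := hg (ε / (‖f‖ + ‖g‖ + 1)) (by positivity)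
    refine ⟨min a b, lt_min ha hb, fun {x y} hxy => ?_⟩
    have h1 := hfa (lt_of_lt_of_le hxy (min_le_left a b))
    have h2 := hgb (lt_of_lt_of_le hxy (min_le_right a b))
    rw [dist_eq_norm, lt_div_iff₀ hC] at h1 h2
    rw [dist_eq_norm, BoundedContinuousFunction.mul_apply, BoundedContinuousFunction.mul_apply,
      show f x * g x - f y * g y = f x * (g x - g y) + (f x - f y) * g y by ring]
    have h3 := norm_add_le (f x * (g x - g y)) ((f x - f y) * g y)
    rw [norm_mul, norm_mul] at h3
    have h4 := f.norm_coe_le_norm x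
    have h5 := g.norm_coe_le_norm y
    have h6 := mul_le_mul_of_nonneg_right h4 (norm_nonneg (g x - g y))
    have h7 := mul_le_mul_of_nonneg_left h5 (norm_nonneg (f x - f y))
    rcases le_total ‖f x - f y‖ ‖g x - g y‖ with h | h
    · have h8 := mul_le_mul_of_nonneg_right h (norm_nonneg g)
      nlinarith [norm_nonneg (g x - g y)]
    · have h8 := mul_le_mul_of_nonneg_left h (norm_nonneg f)
      nlinarith [norm_nonneg (f x - f y)]
  add_mem' {f g} hf hg := UniformContinuous.add hf hg
  algebraMap_mem' c := uniformContinuous_const (b := c)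

/-- `A_u(B)`: the (bounded) uniformly continuous holomorphic functions on the open unit ball. -/
def Au : Subalgebra ℂ (BallFun X) := HInf X ⊓ BUC X

variable {X}

/-- The Arens extension `Ã` to `X**` of a continuous `n`-linear form `A` on `X`, obtained by
extending one variable at a time by weak-star continuity and evaluated at `z₀, …, zₙ₋₁ ∈ X**`:
`Ã (z₀, z₁, …) = z₀ (x ↦ (A (x, ·))~ (z₁, …))`. It is continuous and linear in `A`, so it is
recorded as a continuous linear functional of `A`. -/
def arensExt : (n : ℕ) → (Fin n → Bidual X) →
    (ContinuousMultilinearMap ℂ (fun _ : Fin n => X) ℂ →L[ℂ] ℂ)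
  | 0, _ => (continuousMultilinearCurryFin0 ℂ X ℂ).toContinuousLinearEquiv.toContinuousLinearMap
  | n + 1, z =>
      (z 0).comp
        ((ContinuousLinearMap.compL ℂ X _ ℂ (arensExt n (Fin.tail z))).comp
          (continuousMultilinearCurryLeftEquiv ℂ (fun _ : Fin (n + 1) => X)
            ℂ).toContinuousLinearEquiv.toContinuousLinearMap)

variable (X)

/-- A continuous polynomial `P = P₀ + P₁ + ⋯ + P_d` on `X`, given by the (unique) continuous
symmetric `k`-linear forms of its homogeneous parts `P_k`. -/
structure ContPoly where
  degree : ℕ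
  form : (k : ℕ) → ContinuousMultilinearMap ℂ (fun _ : Fin k => X) ℂ
  symm : ∀ (k : ℕ) (σ : Equiv.Perm (Fin k)) (v : Fin k → X), form k (v ∘ σ) = form k v

variable {X}

/-- The value of a polynomial at a point of `X`. -/
def ContPoly.eval (P : ContPoly X) (x : X) : ℂ :=
  ∑ k ∈ Finset.range (P.degree + 1), P.form k fun _ => x

/-- The Aron-Berner extension of a polynomial to `X**`: the Arens extensions of the symmetric forms,
restricted to the diagonal. -/
def ContPoly.aronBerner (P : ContPoly X) (z : Bidual X) : ℂ :=
  ∑ k ∈ Finset.range (P.degree + 1), arensExt k (fun _ => z) (P.form k)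

/-- The Aron-Berner extension of a bounded holomorphic `f` to the open unit ball of `X**`: the sum
of the Aron-Berner extensions of the terms of the Taylor series of `f` at `0`. -/
def aronBernerOpen (f : ball (0 : X) 1 → ℂ) (w : Bidual X) : ℂ :=
  ∑' m : ℕ, (m.factorial : ℂ)⁻¹ * arensExt m (fun _ => w) (iteratedFDeriv ℂ m (zeroExt f) 0)

/-- For `g ∈ A_u(B)`, the Aron-Berner extension `g̃` on the closed unit ball of `X**`: the
extension by norm continuity of the one on the open unit ball. -/
def aronBerner (g : ball (0 : X) 1 → ℂ) : Bidual X → ℂ :=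
  extendFrom (ball (0 : Bidual X) 1) (aronBernerOpen g)

/-- The polynomial cluster set of `f` at `z`: all limits of `f` along nets (here: proper filters) in
the open unit ball `B` which converge to `z` in the polynomial-star topology. -/
def clusterSet (f : ball (0 : X) 1 → ℂ) (z : Bidual X) : Set ℂ :=
  {c | ∃ l : Filter (ball (0 : X) 1), l.NeBot ∧
    (∀ P : ContPoly X, Tendsto (fun x : ball (0 : X) 1 => P.eval x) l (𝓝 (P.aronBerner z))) ∧
    Tendsto f l (𝓝 c)}

/-- The polynomial fiber over `z`: the characters of `H` whose restriction to `A_u(B)` is the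
evaluation `g ↦ g̃ z`. -/
def polyFiber {H : Subalgebra ℂ (BallFun X)} (hAu : Au X ≤ H) (z : Bidual X) :
    Set (WeakDual.characterSpace ℂ H) :=
  {τ | ∀ (g : BallFun X) (hg : g ∈ Au X), τ ⟨g, hAu hg⟩ = aronBerner g z}

/-- The polynomial cluster value theorem for `H` holds at `z`. -/
def PolyClusterValueTheorem {H : Subalgebra ℂ (BallFun X)} (hAu : Au X ≤ H) (z : Bidual X) :
    Prop :=
  ∀ f : H, clusterSet (f : BallFun X) z =
    (WeakDual.gelfandTransform ℂ H f) '' polyFiber hAu z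

end PolyCluster

end

namespace PolyCluster

/-! The theorem is a compactness argument resting on one fact: the values of any `g ∈ A_u(B)`
converge to `aronBerner g z` along every filter on the ball that converges to `z` in the
polynomial-star topology (`tendsto_aronBerner`). If the cluster value theorem holds and `τ` were a
common zero in the fiber, then `0` would be a cluster value of the last function. Along the
corresponding filter the other functions, which lie in `A_u(B)`, tend to their values under `τ`,
which are `0`, contradicting the lower bound `δ`.

Conversely, cluster values always come from characters, obtained as ultrafilter limits
(`clusterSet_subset_image_polyFiber`). If `τ f` were not a cluster value, finitely many forms `A`
would already detect this: `∑ |A - Ã(z)| + |f - τ f|` is bounded below on the ball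
(`exists_forms_of_notMem_clusterSet`), yet `τ` annihilates each of these functions.

The convergence fact needs the unit ball to be polynomial-star dense in the closed ball of the
bidual (`polyNhds_neBot`), as shown by Davie and Gamelin: choose `x₁, …, x_N` successively by
Goldstine's theorem so that `A(x_{i₁}, …, x_{iₙ})` is close to `Ã(z, …, z)` for increasing indices,
and average. By symmetry increasing indices account for all tuples of distinct indices, and the
proportion of tuples with a repetition tends to `0`. Density gives the norm inequality for
extensions, hence passage from polynomials to their uniform limits, which include all of `A_u(B)`
(`exists_contPoly_norm_sub_le`). -/

/-- A multilinear form in `n` variables is symmetric. -/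
def IsSymmForm {X : Type*} [NormedAddCommGroup X] [NormedSpace ℂ X] {n : ℕ}
    (A : ContinuousMultilinearMap ℂ (fun _ : Fin n => X) ℂ) : Prop :=
  ∀ (σ : Equiv.Perm (Fin n)) (v : Fin n → X), A (v ∘ σ) = A v

/-! ### Elementary identities and inequalities -/

theorem fin_cons_const {α : Type*} {n : ℕ} (x : α) :
    (Fin.cons x (fun _ : Fin n => x) : Fin (n + 1) → α) = fun _ => x := by
  funext i
  refine Fin.cases ?_ (fun j => ?_) i <;> simp

theorem norm_list_sum_le_length {E : Type*} [SeminormedAddCommGroup E] (L : List E) (hL : ∀ x ∈ L, ‖x‖ ≤ 1) :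
    ‖L.sum‖ ≤ L.length := by
  induction L with
  | nil => simp
  | cons x L ih =>
    rw [List.sum_cons, List.length_cons]
    push_cast
    have h1 := ih fun y hy => hL y (List.mem_cons_of_mem _ hy)
    have h2 := hL x List.mem_cons_self
    exact (norm_add_le _ _).trans (by linarith)

/-- What remains of the binomial expansion after its two highest powers of `r` are removed has
nonnegative terms. -/
theorem succ_mul_pow_le_pow_succ_sub {r : ℝ} (hr : 0 ≤ r) (n : ℕ) :
    0 ≤ (r + 1) ^ (n + 1) - r ^ (n + 1) - (n + 1) * r ^ n := by
  induction n with
  | zero => simp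
  | succ n ih =>
    have h1 : r ^ (n + 1) ≤ (r + 1) ^ (n + 1) := by gcongr; linarith
    have h2 := mul_nonneg hr ih
    push_cast
    nlinarith [pow_succ r n, pow_succ r (n + 1), pow_succ (r + 1) (n + 1)]

theorem cast_succ_descFactorial_succ (N n : ℕ) : ((N + 1).descFactorial (n + 1) : ℝ) =
    N.descFactorial (n + 1) + (n + 1) * N.descFactorial n := by
  rw [Nat.descFactorial_eq_factorial_mul_choose, Nat.descFactorial_eq_factorial_mul_choose,
    Nat.descFactorial_eq_factorial_mul_choose, Nat.choose_succ_succ, Nat.factorial_succ]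
  push_cast
  ring

/-! ### Symmetric forms evaluated at sums of vectors -/

section Symmetric

variable {X : Type*} [NormedAddCommGroup X] [NormedSpace ℂ X]

theorem curryLeft_apply_const {n : ℕ} (A : ContinuousMultilinearMap ℂ (fun _ : Fin (n + 1) => X) ℂ)
    (x : X) : A.curryLeft x (fun _ => x) = A fun _ => x := by
  rw [ContinuousMultilinearMap.curryLeft_apply, fin_cons_const]

theorem apply_const_add {n : ℕ} (A : ContinuousMultilinearMap ℂ (fun _ : Fin (n + 1) => X) ℂ)
    (x s : X) : (A fun _ => x + s) =
      A.curryLeft x (fun _ => x + s) + A.curryLeft s (fun _ => x + s) := by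
  rw [← curryLeft_apply_const, map_add, add_apply]

theorem IsSymmForm.curryLeft {n : ℕ} {A : ContinuousMultilinearMap ℂ (fun _ : Fin (n + 1) => X) ℂ}
    (hA : IsSymmForm A) (x : X) : IsSymmForm (A.curryLeft x) := by
  intro σ v
  rw [ContinuousMultilinearMap.curryLeft_apply, ContinuousMultilinearMap.curryLeft_apply,
    ← hA (Equiv.Perm.decomposeFin.symm (0, σ)) (Fin.cons x v)]
  congr 1
  funext i
  refine Fin.cases ?_ (fun j => ?_) i <;> simp

theorem IsSymmForm.curryLeft_swap {n : ℕ}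
    {A : ContinuousMultilinearMap ℂ (fun _ : Fin (n + 2) => X) ℂ}
    (hA : IsSymmForm A) (x s : X) (v : Fin n → X) :
    (A.curryLeft s).curryLeft x v = (A.curryLeft x).curryLeft s v := by
  simp only [ContinuousMultilinearMap.curryLeft_apply]
  rw [← hA (Equiv.swap 0 1) (Fin.cons s (Fin.cons x v))]
  congr 1
  funext i
  refine Fin.cases ?_ (fun j => Fin.cases ?_ (fun k => ?_) j) i
  · simp
  · simp
  · have : Equiv.swap (0 : Fin (n + 2)) 1 k.succ.succ = k.succ.succ :=
      Equiv.swap_apply_of_ne_of_ne (Fin.succ_ne_zero _)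
        (fun h => Fin.succ_ne_zero k (Fin.succ_injective _ h))
    simp [this]

theorem norm_curryLeft_apply_le {n : ℕ}
    (A : ContinuousMultilinearMap ℂ (fun _ : Fin (n + 1) => X) ℂ) (x : X) :
    ‖A.curryLeft x‖ ≤ ‖A‖ * ‖x‖ := by
  simpa using A.curryLeft.le_opNorm x

theorem norm_apply_const_le {n : ℕ}
    (A : ContinuousMultilinearMap ℂ (fun _ : Fin n => X) ℂ) {x : X} {r : ℝ} (hx : ‖x‖ ≤ r) :
    ‖A fun _ => x‖ ≤ ‖A‖ * r ^ n := by
  refine (A.le_opNorm _).trans ?_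
  simp only [Finset.prod_const, Finset.card_univ, Fintype.card_fin]
  gcongr

/-- Every term of the multilinear expansion except `A(s, …, s)` contains `x`; the scalar expansion
of `(r + 1) ^ n` majorises them. -/
theorem norm_apply_const_add_sub_le {n : ℕ}
    (A : ContinuousMultilinearMap ℂ (fun _ : Fin n => X) ℂ) {x s : X} {r : ℝ}
    (hx : ‖x‖ ≤ 1) (hs : ‖s‖ ≤ r) :
    ‖(A fun _ => x + s) - A fun _ => s‖ ≤ ‖A‖ * ((r + 1) ^ n - r ^ n) := by
  have hr : 0 ≤ r := (norm_nonneg s).trans hs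
  have hxs : ‖x + s‖ ≤ r + 1 := (norm_add_le _ _).trans (by linarith)
  induction n with
  | zero => simp [Subsingleton.elim (fun _ : Fin 0 => x + s) (fun _ => s)]
  | succ n ih =>
    have h1 : ‖A.curryLeft x‖ ≤ ‖A‖ :=
      (norm_curryLeft_apply_le A x).trans (mul_le_of_le_one_right (norm_nonneg _) hx)
    have h2 : ‖A.curryLeft s‖ ≤ ‖A‖ * r :=
      (norm_curryLeft_apply_le A s).trans (by gcongr)
    have h3 := norm_apply_const_le (A.curryLeft x) hxs
    have h4 := ih (A.curryLeft s)
    have h5 : 0 ≤ (r + 1) ^ n - r ^ n := sub_nonneg.2 (by gcongr; linarith)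
    rw [apply_const_add, ← curryLeft_apply_const A s, add_sub_assoc]
    refine (norm_add_le _ _).trans ?_
    calc _ ≤ ‖A‖ * (r + 1) ^ n + ‖A‖ * r * ((r + 1) ^ n - r ^ n) := by
          refine add_le_add (h3.trans ?_) (h4.trans ?_) <;> gcongr
      _ = _ := by ring

/-- The part of `A (x + s, …, x + s)` of degree at least two in `x`. -/
theorem IsSymmForm.norm_taylor_remainder_le {n : ℕ}
    {A : ContinuousMultilinearMap ℂ (fun _ : Fin (n + 1) => X) ℂ} (hA : IsSymmForm A)
    {x s : X} {r : ℝ} (hx : ‖x‖ ≤ 1) (hs : ‖s‖ ≤ r) :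
    ‖(A fun _ => x + s) - (A fun _ => s) - (n + 1) * A.curryLeft x fun _ => s‖ ≤
      ‖A‖ * ((r + 1) ^ (n + 1) - r ^ (n + 1) - (n + 1) * r ^ n) := by
  have hr : 0 ≤ r := (norm_nonneg s).trans hs
  induction n with
  | zero =>
    rw [apply_const_add, ← curryLeft_apply_const A s,
      Subsingleton.elim (fun _ : Fin 0 => x + s) (fun _ => s)]
    simp
  | succ n ih =>
    have h1 : ‖A.curryLeft x‖ ≤ ‖A‖ :=
      (norm_curryLeft_apply_le A x).trans (mul_le_of_le_one_right (norm_nonneg _) hx)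
    have h2 : ‖A.curryLeft s‖ ≤ ‖A‖ * r :=
      (norm_curryLeft_apply_le A s).trans (by gcongr)
    have h3 := norm_apply_const_add_sub_le (A.curryLeft x) hx hs
    have h4 := ih (hA.curryLeft s)
    have h5 : 0 ≤ (r + 1) ^ (n + 1) - r ^ (n + 1) := sub_nonneg.2 (by gcongr; linarith)
    have h6 : 0 ≤ (r + 1) ^ (n + 1) - r ^ (n + 1) - (n + 1) * r ^ n :=
      succ_mul_pow_le_pow_succ_sub hr n
    -- Symmetry merges the linear term with `x` in the first slot and those with `x` in a later slot
    -- into one multiple of `A(x, s, …, s)`.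
    have h7 : ((A.curryLeft s).curryLeft x fun _ => s) = A.curryLeft x fun _ => s := by
      rw [hA.curryLeft_swap, curryLeft_apply_const]
    rw [h7] at h4
    have h8 : (A fun _ => x + s) - (A fun _ => s) - ((n + 1 : ℕ) + 1) * (A.curryLeft x fun _ => s) =
        ((A.curryLeft x fun _ => x + s) - A.curryLeft x fun _ => s) +
        ((A.curryLeft s fun _ => x + s) - (A.curryLeft s fun _ => s) -
          (n + 1) * A.curryLeft x fun _ => s) := by
      rw [apply_const_add, ← curryLeft_apply_const A s]
      push_cast
      ring
    rw [h8]
    refine (norm_add_le _ _).trans ?_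
    calc _ ≤ ‖A‖ * ((r + 1) ^ (n + 1) - r ^ (n + 1)) +
          ‖A‖ * r * ((r + 1) ^ (n + 1) - r ^ (n + 1) - (n + 1) * r ^ n) := by
          refine add_le_add (h3.trans ?_) (h4.trans ?_) <;> gcongr
      _ = _ := by push_cast; ring

/-- The sum of `A (x_{i₁}, …, x_{iₙ})` over the increasing `n`-tuples `i₁ < ⋯ < iₙ` of indices of a
list `x`. -/
noncomputable def incSum : List X → (n : ℕ) →
    ContinuousMultilinearMap ℂ (fun _ : Fin n => X) ℂ → ℂ
  | _, 0, A => A 0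
  | [], _ + 1, _ => 0
  | x :: L, n + 1, A => incSum L n (A.curryLeft x) + incSum L (n + 1) A

theorem incSum_zero (L : List X) (A : ContinuousMultilinearMap ℂ (fun _ : Fin 0 => X) ℂ) :
    incSum L 0 A = A 0 := by
  cases L <;> rfl

/-- By symmetry the tuples of distinct indices contribute exactly `n!` times the increasing ones.
The error comes from tuples with a repeated index; there are `N ^ n - N (N - 1) ⋯ (N - n + 1)` of
them, each contributing at most `‖A‖`. -/
theorem IsSymmForm.norm_apply_sum_sub_incSum_le {n : ℕ}
    {A : ContinuousMultilinearMap ℂ (fun _ : Fin n => X) ℂ} (hA : IsSymmForm A)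
    (L : List X) (hL : ∀ x ∈ L, ‖x‖ ≤ 1) :
    ‖(A fun _ => L.sum) - n.factorial * incSum L n A‖ ≤
      ‖A‖ * ((L.length : ℝ) ^ n - L.length.descFactorial n) := by
  induction L generalizing n with
  | nil =>
    cases n with
    | zero => simp [incSum, Subsingleton.elim (fun _ : Fin 0 => (0 : X)) 0]
    | succ n =>
      have : (A fun _ => (0 : X)) = 0 := A.map_zero
      simp [incSum, this]
  | cons x L ih =>
    have hL' : ∀ y ∈ L, ‖y‖ ≤ 1 := fun y hy => hL y (List.mem_cons_of_mem _ hy)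
    have hx := hL x List.mem_cons_self
    cases n with
    | zero => simp [incSum, Subsingleton.elim (fun _ : Fin 0 => x + L.sum) 0]
    | succ n =>
      have h1 := hA.norm_taylor_remainder_le hx (norm_list_sum_le_length L hL')
      have h2 := ih hA hL'
      have h3 := ih (hA.curryLeft x) hL'
      have h4 : ‖A.curryLeft x‖ ≤ ‖A‖ :=
        (norm_curryLeft_apply_le A x).trans (mul_le_of_le_one_right (norm_nonneg _) hx)
      have h5 : (0 : ℝ) ≤ (L.length : ℝ) ^ n - L.length.descFactorial n :=
        sub_nonneg.2 (by exact_mod_cast Nat.descFactorial_le_pow _ _)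
      have h6 := h3.trans (mul_le_mul_of_nonneg_right h4 h5)
      -- Split by degree in the new vector `x`: degree at least two is all repetition, degrees zero
      -- and one go to the induction hypothesis for `A` and `A(x, ·)`.
      have h7 : (A fun _ => (x :: L).sum) - (n + 1).factorial * incSum (x :: L) (n + 1) A =
          ((A fun _ => x + L.sum) - (A fun _ => L.sum) - (n + 1) * A.curryLeft x fun _ => L.sum) +
          ((A fun _ => L.sum) - (n + 1).factorial * incSum L (n + 1) A) +
          (n + 1) * ((A.curryLeft x fun _ => L.sum) - n.factorial * incSum L n (A.curryLeft x)) := by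
        rw [List.sum_cons, incSum, Nat.factorial_succ]
        push_cast
        ring
      have h8 : ((L.length + 1).descFactorial (n + 1) : ℝ) =
          L.length.descFactorial (n + 1) + (n + 1) * L.length.descFactorial n :=
        cast_succ_descFactorial_succ _ _
      rw [h7]
      refine (norm_add_le _ _).trans ((add_le_add (norm_add_le _ _) le_rfl).trans ?_)
      rw [norm_mul, show ‖(n + 1 : ℂ)‖ = n + 1 by exact_mod_cast Complex.norm_natCast (n + 1)]
      calc _ ≤ _ := add_le_add (add_le_add h1 h2)
            (mul_le_mul_of_nonneg_left h6 (by positivity : (0 : ℝ) ≤ n + 1))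
        _ = _ := by rw [List.length_cons, h8]; push_cast; ring

end Symmetric

/-! ### Goldstine's theorem -/

section Goldstine

variable {X : Type*} [NormedAddCommGroup X] [NormedSpace ℂ X]

/-- Goldstine's theorem for finitely many functionals. -/
theorem exists_mem_ball_forall_norm_sub_lt {z : Bidual X} (hz : ‖z‖ ≤ 1)
    (I : Finset (StrongDual ℂ X)) {ε : ℝ} (hε : 0 < ε) :
    ∃ x ∈ ball (0 : X) 1, ∀ φ ∈ I, ‖φ x - z φ‖ < ε := by
  let T : X →L[ℂ] (I → ℂ) := ContinuousLinearMap.pi fun φ => (φ : StrongDual ℂ X)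
  let p : I → ℂ := fun φ => z φ
  by_cases hp : p ∈ closure (T '' ball (0 : X) 1)
  · obtain ⟨_, ⟨x, hx, rfl⟩, hd⟩ := Metric.mem_closure_iff.1 hp ε hε
    refine ⟨x, hx, fun φ hφ => ?_⟩
    have := (dist_pi_lt_iff hε).1 hd ⟨φ, hφ⟩
    rwa [dist_comm, dist_eq_norm] at this
  · exfalso
    have hconv : Convex ℝ (closure (T '' ball (0 : X) 1)) :=
      ((convex_ball (0 : X) 1).linear_image (T.toLinearMap.restrictScalars ℝ)).closure
    obtain ⟨f, u, hfu, hup⟩ :=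
      RCLike.geometric_hahn_banach_closed_point (𝕜 := ℂ) hconv isClosed_closure hp
    classical
    -- The separating functional pulls back to a linear combination of members of `I`, on which `z`
    -- is known.
    have hψ : z (f.comp T) = f p := by
      have h1 : f.comp T = ∑ φ : I, f (fun j => if φ = j then 1 else 0) • (φ : StrongDual ℂ X) := by
        ext x
        have := f.toLinearMap.pi_apply_eq_sum_univ (T x)
        simp only [ContinuousLinearMap.coe_coe] at this
        simp only [ContinuousLinearMap.comp_apply, this]
        simp [T, mul_comm]
      have h2 := f.toLinearMap.pi_apply_eq_sum_univ p
      simp only [ContinuousLinearMap.coe_coe] at h2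
      rw [h2, h1, map_sum]
      simp [p, mul_comm]
    have hlt : u < ‖f.comp T‖ := by
      rw [← hψ] at hup
      calc u < _ := hup
        _ ≤ ‖z (f.comp T)‖ := RCLike.re_le_norm _
        _ ≤ ‖z‖ * ‖f.comp T‖ := z.le_opNorm _
        _ ≤ _ := mul_le_of_le_one_left (norm_nonneg _) hz
    obtain ⟨x, hx, hux⟩ := ContinuousLinearMap.exists_lt_apply_of_lt_opNorm _ hlt
    -- Rotating `x` by a unimodular `c` turns the modulus into a real part, which exceeds the
    -- separating level `u`.
    obtain ⟨c, hc, hcx⟩ := RCLike.exists_norm_eq_mul_self (K := ℂ) ((f.comp T) x)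
    have h3 := hfu (T (c • x)) (subset_closure ⟨c • x, by simpa [norm_smul, hc] using hx, rfl⟩)
    have h4 : f (T (c • x)) = c * (f.comp T) x := by simp
    rw [h4, ← hcx, RCLike.ofReal_re] at h3
    exact lt_asymm h3 hux

end Goldstine

/-! ### Approximating Arens extensions by averages of points of the ball -/

section Arens

variable {X : Type*} [NormedAddCommGroup X] [NormedSpace ℂ X]

theorem arensExt_zero (z : Fin 0 → Bidual X)
    (A : ContinuousMultilinearMap ℂ (fun _ : Fin 0 => X) ℂ) : arensExt 0 z A = A 0 := rfl

theorem arensExt_const_succ {n : ℕ} (z : Bidual X)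
    (A : ContinuousMultilinearMap ℂ (fun _ : Fin (n + 1) => X) ℂ) :
    arensExt (n + 1) (fun _ => z) A = z ((arensExt n fun _ => z).comp
      (continuousMultilinearCurryLeftEquiv ℂ (fun _ : Fin (n + 1) => X) ℂ A)) := rfl

theorem arensExt_const_smul {n : ℕ} (c : ℂ) (z : Bidual X)
    (A : ContinuousMultilinearMap ℂ (fun _ : Fin n => X) ℂ) :
    arensExt n (fun _ => c • z) A = c ^ n * arensExt n (fun _ => z) A := by
  induction n with
  | zero => simp [arensExt_zero]
  | succ n ih =>
    have h : (arensExt n fun _ => c • z).comp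
        (continuousMultilinearCurryLeftEquiv ℂ (fun _ : Fin (n + 1) => X) ℂ A) =
        c ^ n • (arensExt n fun _ => z).comp
          (continuousMultilinearCurryLeftEquiv ℂ (fun _ : Fin (n + 1) => X) ℂ A) := by
      ext x
      exact ih _
    rw [arensExt_const_succ, arensExt_const_succ, h, map_smul, smul_apply,
      smul_eq_mul, smul_eq_mul]
    ring

theorem continuous_arensExt (n : ℕ) : Continuous (arensExt n : (Fin n → Bidual X) → _) := by
  induction n with
  | zero => exact continuous_const
  | succ n ih =>
    have h1 : Continuous fun z : Fin (n + 1) → Bidual X => arensExt n (Fin.tail z) :=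
      ih.comp (continuous_pi fun i => continuous_apply i.succ)
    exact (continuous_apply 0).clm_comp
      (((ContinuousLinearMap.compL ℂ X _ ℂ).continuous.comp h1).clm_comp continuous_const)

/-- A form with its first variable fixed. -/
noncomputable def fixFirst (x : X) :
    (Σ n, ContinuousMultilinearMap ℂ (fun _ : Fin n => X) ℂ) →
      Σ n, ContinuousMultilinearMap ℂ (fun _ : Fin n => X) ℂ
  | ⟨0, A⟩ => ⟨0, A⟩
  | ⟨n + 1, A⟩ => ⟨n, A.curryLeft x⟩

/-- The linear functional obtained from a form by extending all variables but the first to the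
bidual. -/
noncomputable def partialExt (z : Bidual X) :
    (Σ n, ContinuousMultilinearMap ℂ (fun _ : Fin n => X) ℂ) → StrongDual ℂ X
  | ⟨0, _⟩ => 0
  | ⟨n + 1, A⟩ => (arensExt n fun _ => z).comp
      (continuousMultilinearCurryLeftEquiv ℂ (fun _ : Fin (n + 1) => X) ℂ A)

open scoped Classical in
-- The approximation is only available for increasing indices, because each vector is chosen after
-- the earlier ones are fixed; there are `N.choose n` such tuples.
theorem exists_list_norm_incSum_sub_le {z : Bidual X} (hz : ‖z‖ ≤ 1) (N : ℕ)
    (I : Finset (Σ n, ContinuousMultilinearMap ℂ (fun _ : Fin n => X) ℂ)) {ε : ℝ} (hε : 0 < ε) :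
    ∃ L : List X, L.length = N ∧ (∀ x ∈ L, x ∈ ball (0 : X) 1) ∧
      ∀ A ∈ I, ‖incSum L A.1 A.2 - N.choose A.1 * arensExt A.1 (fun _ => z) A.2‖ ≤ ε := by
  induction N generalizing I ε with
  | zero =>
    refine ⟨[], rfl, by simp, ?_⟩
    rintro ⟨n, A⟩ -
    cases n <;> simpa [incSum, arensExt_zero] using hε.le
  | succ N ih =>
    -- The head approximates `z` on the functionals whose later variables are already extended; the
    -- tail then has to serve both `A` and `A(x, ·)`. The factor `2 ^ N` absorbs the binomial
    -- coefficient multiplying the error of `x`.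
    obtain ⟨x, hx, hxI⟩ := exists_mem_ball_forall_norm_sub_lt hz (I.image (partialExt z))
      (show 0 < ε / 3 / 2 ^ N by positivity)
    obtain ⟨L, hLN, hLx, hLI⟩ := ih (I ∪ I.image (fixFirst x)) (show 0 < ε / 3 by positivity)
    refine ⟨x :: L, by simp [hLN], ?_, ?_⟩
    · rintro y hy
      rcases List.mem_cons.1 hy with rfl | hy
      exacts [hx, hLx y hy]
    rintro ⟨n, A⟩ hA
    cases n with
    | zero => simpa [incSum_zero, arensExt_zero] using hε.le
    | succ n =>
      have h1 := hLI ⟨n + 1, A⟩ (Finset.mem_union_left _ hA)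
      have h2 := hLI ⟨n, A.curryLeft x⟩
        (Finset.mem_union_right _ (Finset.mem_image_of_mem (fixFirst x) hA))
      have h3 := (hxI _ (Finset.mem_image_of_mem (partialExt z) hA)).le
      change ‖arensExt n (fun _ => z) (A.curryLeft x) - arensExt (n + 1) (fun _ => z) A‖ ≤ _ at h3
      dsimp only at h1 h2 ⊢
      have h4 : ‖(N.choose n : ℂ) * (arensExt n (fun _ => z) (A.curryLeft x) -
          arensExt (n + 1) (fun _ => z) A)‖ ≤ ε / 3 := by
        rw [norm_mul, Complex.norm_natCast]
        calc _ ≤ (2 : ℝ) ^ N * (ε / 3 / 2 ^ N) := by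
              gcongr
              exact_mod_cast Nat.choose_le_two_pow N n
          _ = _ := by field_simp
      have h5 : incSum (x :: L) (n + 1) A -
          ((N + 1).choose (n + 1) : ℕ) * arensExt (n + 1) (fun _ => z) A =
          (incSum L (n + 1) A - N.choose (n + 1) * arensExt (n + 1) (fun _ => z) A) +
          (incSum L n (A.curryLeft x) - N.choose n * arensExt n (fun _ => z) (A.curryLeft x)) +
          (N.choose n : ℂ) * (arensExt n (fun _ => z) (A.curryLeft x) -
            arensExt (n + 1) (fun _ => z) A) := by
        rw [incSum, Nat.choose_succ_succ]
        push_cast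
        ring
      rw [h5]
      refine (norm_add₃_le).trans ?_
      linarith

/-- Finitely many symmetric forms on the diagonal can be approximated simultaneously, on the unit
ball, to their Arens extensions at a point of the closed unit ball of the bidual. -/
theorem exists_seq_tendsto_arensExt {z : Bidual X} (hz : ‖z‖ ≤ 1)
    (I : Finset (Σ n, ContinuousMultilinearMap ℂ (fun _ : Fin n => X) ℂ))
    (hI : ∀ A ∈ I, IsSymmForm A.2) :
    ∃ y : ℕ → X, (∀ N, y N ∈ ball (0 : X) 1) ∧ ∀ A ∈ I,
      Tendsto (fun N => A.2 fun _ => y N) atTop (𝓝 (arensExt A.1 (fun _ => z) A.2)) := by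
  choose L hLN hLx hLI using fun N : ℕ => exists_list_norm_incSum_sub_le hz N I
    (show (0 : ℝ) < 1 / ((N : ℝ) + 1) by positivity)
  -- The averages of the chosen vectors; for `N = 0` this is the point `0`.
  refine ⟨fun N => (N : ℂ)⁻¹ • (L N).sum, fun N => ?_, fun A hA => ?_⟩
  · have h : ∀ M : List X, M ≠ [] → (∀ x ∈ M, x ∈ ball (0 : X) 1) → ‖M.sum‖ < M.length := by
      intro M hM hMx
      cases M with
      | nil => exact absurd rfl hM
      | cons x M =>
        have h1 := norm_list_sum_le_length M fun y hy =>
          (mem_ball_zero_iff.1 (hMx y (List.mem_cons_of_mem _ hy))).le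
        have h2 := mem_ball_zero_iff.1 (hMx x List.mem_cons_self)
        rw [List.sum_cons, List.length_cons]
        push_cast
        exact (norm_add_le _ _).trans_lt (by linarith)
    rcases Nat.eq_zero_or_pos N with rfl | hN
    · simp
    · have h1 := h (L N) (fun h0 => by have := hLN N; simp [h0] at this; omega) (hLx N)
      rw [hLN] at h1
      have hN' : (0 : ℝ) < N := by exact_mod_cast hN
      rw [mem_ball_zero_iff, norm_smul, norm_inv, Complex.norm_natCast, inv_mul_lt_iff₀ hN']
      simpa using h1
  · obtain ⟨n, A⟩ := A
    dsimp only
    set a := arensExt n (fun _ => z) A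
    -- The proportion of `n`-tuples of indices without repetition tends to `1`.
    have hρ : Tendsto (fun N : ℕ => (N.descFactorial n : ℝ) / (N : ℝ) ^ n) atTop (𝓝 1) := by
      refine (Asymptotics.isEquivalent_iff_tendsto_one ?_).1 (isEquivalent_descFactorial n)
      filter_upwards [eventually_gt_atTop 0] with N hN
      have : (N : ℝ) ≠ 0 := by exact_mod_cast hN.ne'
      positivity
    have hb : Tendsto (fun N : ℕ => ‖A‖ * (1 - (N.descFactorial n : ℝ) / (N : ℝ) ^ n) +
        n.factorial * (1 / ((N : ℝ) + 1)) + (1 - (N.descFactorial n : ℝ) / (N : ℝ) ^ n) * ‖a‖)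
        atTop (𝓝 0) := by
      have h1 : Tendsto (fun N : ℕ => 1 - (N.descFactorial n : ℝ) / (N : ℝ) ^ n) atTop (𝓝 0) := by
        simpa using hρ.const_sub 1
      simpa using ((h1.const_mul ‖A‖).add
        ((tendsto_one_div_add_atTop_nhds_zero_nat (𝕜 := ℝ)).const_mul (n.factorial : ℝ))).add
          (h1.mul_const ‖a‖)
    rw [tendsto_iff_norm_sub_tendsto_zero]
    refine squeeze_zero' (Eventually.of_forall fun N => norm_nonneg _) ?_ hb
    filter_upwards [eventually_gt_atTop 0] with N hN
    have hN1 : (1 : ℝ) ≤ N := by exact_mod_cast hN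
    have hN0 : (N : ℂ) ≠ 0 := by exact_mod_cast hN.ne'
    have hNn : (1 : ℝ) ≤ (N : ℝ) ^ n := one_le_pow₀ hN1
    have h1 := (hI _ hA).norm_apply_sum_sub_incSum_le (L N)
      fun x hx => (mem_ball_zero_iff.1 (hLx N x hx)).le
    have h2 := hLI N _ hA
    dsimp only at h1 h2
    rw [hLN] at h1
    have h3 : (A fun _ => (N : ℂ)⁻¹ • (L N).sum) = ((N : ℂ) ^ n)⁻¹ * A fun _ => (L N).sum := by
      have := A.map_smul_univ (fun _ => (N : ℂ)⁻¹) (fun _ => (L N).sum)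
      simpa using this
    have h4 : (N.descFactorial n : ℂ) = n.factorial * N.choose n := by
      rw [Nat.descFactorial_eq_factorial_mul_choose]; push_cast; ring
    -- Three errors: tuples with repetition, the approximation on increasing tuples, and the missing
    -- proportion of tuples.
    have h5 : ((N : ℂ) ^ n)⁻¹ * (A fun _ => (L N).sum) - a =
        ((N : ℂ) ^ n)⁻¹ * ((A fun _ => (L N).sum) - n.factorial * incSum (L N) n A) +
        ((N : ℂ) ^ n)⁻¹ * (n.factorial * (incSum (L N) n A - N.choose n * a)) +
        ((((N.descFactorial n : ℝ) / (N : ℝ) ^ n - 1 : ℝ)) : ℂ) * a := by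
      push_cast
      rw [h4]
      field_simp
      ring
    have h6 : (N.descFactorial n : ℝ) / (N : ℝ) ^ n ≤ 1 :=
      div_le_one_of_le₀ (by exact_mod_cast Nat.descFactorial_le_pow _ _) (by positivity)
    rw [h3, h5]
    refine norm_add₃_le.trans (add_le_add (add_le_add ?_ ?_) ?_)
    · rw [norm_mul, norm_inv, norm_pow, Complex.norm_natCast, inv_mul_le_iff₀ (by positivity)]
      refine h1.trans_eq ?_
      field_simp
    · rw [norm_mul, norm_inv, norm_pow, Complex.norm_natCast, norm_mul, Complex.norm_natCast]
      calc _ ≤ 1 * (n.factorial * (1 / ((N : ℝ) + 1))) := by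
            gcongr
            exact inv_le_one_of_one_le₀ hNn
        _ = _ := one_mul _
    · rw [norm_mul, Complex.norm_real, Real.norm_eq_abs, abs_sub_comm, abs_of_nonneg (by linarith)]

end Arens

/-! ### The polynomial-star topology and density of the ball -/

section PolyFilter

variable {X : Type*} [NormedAddCommGroup X] [NormedSpace ℂ X]

variable (X) in
/-- The continuous symmetric multilinear forms on `X`. -/
abbrev SymmForm : Type _ :=
  {A : Σ n, ContinuousMultilinearMap ℂ (fun _ : Fin n => X) ℂ // IsSymmForm A.2}

/-- The restriction of a form to the diagonal, evaluated at points of the unit ball. -/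
noncomputable def SymmForm.eval (A : SymmForm X) (x : ball (0 : X) 1) : ℂ := A.1.2 fun _ => (x : X)

/-- The Aron-Berner extension of the homogeneous polynomial given by a form. -/
noncomputable def SymmForm.ext (A : SymmForm X) (z : Bidual X) : ℂ :=
  arensExt A.1.1 (fun _ => z) A.1.2

/-- The trace on the unit ball of the neighbourhoods of `z` in the polynomial-star topology. -/
noncomputable def polyNhds (z : Bidual X) : Filter (ball (0 : X) 1) :=
  comap (fun x (A : SymmForm X) => A.eval x) (𝓝 fun A => A.ext z)

theorem tendsto_symmForm_eval (A : SymmForm X) (z : Bidual X) :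
    Tendsto A.eval (polyNhds z) (𝓝 (A.ext z)) :=
  ((continuous_apply A).tendsto fun A : SymmForm X => A.ext z).comp
    (tendsto_comap (f := fun (x : ball (0 : X) 1) (A : SymmForm X) => A.eval x))

theorem tendsto_contPoly_eval (P : ContPoly X) (z : Bidual X) :
    Tendsto (fun x : ball (0 : X) 1 => P.eval x) (polyNhds z) (𝓝 (P.aronBerner z)) :=
  tendsto_finsetSum _ fun k _ => tendsto_symmForm_eval (⟨⟨k, P.form k⟩, P.symm k⟩ : SymmForm X) z

theorem exists_finset_of_mem_nhds_pi {ι : Type*} {c : ι → ℂ} {s : Set (ι → ℂ)} (hs : s ∈ 𝓝 c) :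
    ∃ (I : Finset ι) (ε : ℝ), 0 < ε ∧ ∀ v : ι → ℂ, (∀ i ∈ I, ‖v i - c i‖ < ε) → v ∈ s := by
  rw [nhds_pi, Filter.mem_pi'] at hs
  obtain ⟨I, t, ht, hts⟩ := hs
  choose ε hε hεt using fun i => Metric.mem_nhds_iff.1 (ht i)
  obtain ⟨δ, hδ, hδε⟩ : ∃ δ > 0, ∀ i ∈ I, δ ≤ ε i := by
    rcases I.eq_empty_or_nonempty with rfl | hI
    · exact ⟨1, one_pos, by simp⟩
    · exact ⟨I.inf' hI ε, (Finset.lt_inf'_iff hI).2 fun i _ => hε i,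
        fun i hi => Finset.inf'_le _ hi⟩
  refine ⟨I, δ, hδ, fun v hv => hts fun i hi => hεt i ?_⟩
  rw [mem_ball, dist_eq_norm]
  exact (hv i hi).trans_le (hδε i hi)

/-- A basic neighbourhood constrains only finitely many forms, so the averages eventually enter it.
-/
theorem polyNhds_neBot {z : Bidual X} (hz : ‖z‖ ≤ 1) : (polyNhds z).NeBot := by
  refine comap_neBot fun s hs => ?_
  obtain ⟨I, ε, hε, h⟩ := exists_finset_of_mem_nhds_pi hs
  obtain ⟨y, hy, hyI⟩ := exists_seq_tendsto_arensExt hz (I.map (Function.Embedding.subtype _))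
    fun A hA => by
      obtain ⟨A, -, rfl⟩ := Finset.mem_map.1 hA
      exact A.2
  have : ∀ᶠ N in atTop, ∀ A ∈ I, ‖A.eval ⟨y N, hy N⟩ - A.ext z‖ < ε := by
    refine (Finset.eventually_all I).2 fun A hA => ?_
    have := (Metric.tendsto_nhds.1 (hyI A.1 (Finset.mem_map_of_mem _ hA))) ε hε
    filter_upwards [this] with N hN
    rwa [dist_eq_norm] at hN
  obtain ⟨N, hN⟩ := this.exists
  exact ⟨⟨y N, hy N⟩, h _ hN⟩

/-- The Davie-Gamelin inequality. -/
theorem ContPoly.norm_aronBerner_sub_le {P Q : ContPoly X} {C : ℝ}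
    (h : ∀ x : ball (0 : X) 1, ‖P.eval x - Q.eval x‖ ≤ C) {z : Bidual X} (hz : ‖z‖ ≤ 1) :
    ‖P.aronBerner z - Q.aronBerner z‖ ≤ C :=
  have := polyNhds_neBot hz
  le_of_tendsto ((tendsto_contPoly_eval P z).sub (tendsto_contPoly_eval Q z)).norm
    (Eventually.of_forall h)

theorem SymmForm.norm_ext_le {A : SymmForm X} {C : ℝ}
    (h : ∀ x : ball (0 : X) 1, ‖A.eval x‖ ≤ C) {z : Bidual X} (hz : ‖z‖ ≤ 1) :
    ‖A.ext z‖ ≤ C :=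
  have := polyNhds_neBot hz
  le_of_tendsto (tendsto_symmForm_eval A z).norm (Eventually.of_forall h)

theorem ContPoly.continuous_aronBerner (P : ContPoly X) : Continuous P.aronBerner := by
  refine continuous_finsetSum _ fun k _ => ?_
  have h : Continuous fun z : Bidual X => arensExt k fun _ => z :=
    (continuous_arensExt k).comp (continuous_pi fun _ => continuous_id)
  exact h.clm_apply continuous_const

/-- The polynomial `x ↦ P (c x)`. -/
noncomputable def ContPoly.scale (c : ℂ) (P : ContPoly X) : ContPoly X where
  degree := P.degree
  form k := c ^ k • P.form k
  symm k σ v := by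
    rw [smul_apply, smul_apply, P.symm]

theorem ContPoly.eval_scale (c : ℂ) (P : ContPoly X) (x : X) :
    (P.scale c).eval x = P.eval (c • x) := by
  refine Finset.sum_congr rfl fun k _ => ?_
  have := (P.form k).map_smul_univ (fun _ => c) (fun _ => x)
  simpa [ContPoly.scale] using this.symm

theorem ContPoly.aronBerner_scale (c : ℂ) (P : ContPoly X) (z : Bidual X) :
    (P.scale c).aronBerner z = P.aronBerner (c • z) := by
  refine Finset.sum_congr rfl fun k _ => ?_
  rw [arensExt_const_smul]
  simp [ContPoly.scale]

theorem SymmForm.isHolo_eval (A : SymmForm X) : IsHolo A.eval := by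
  refine IsHolo.congr (F := fun x => A.1.2 fun _ => x) (fun x _ => ?_) fun x => rfl
  exact A.1.2.analyticAt.comp (analyticAt_pi_iff.2 fun _ => analyticAt_id)

/-- The restriction of a form to the diagonal, as a bounded function on the unit ball. -/
noncomputable def SymmForm.toBallFun (A : SymmForm X) : BallFun X :=
  BoundedContinuousFunction.ofNormedAddCommGroup A.eval
    (A.1.2.cont.comp (continuous_pi fun _ => continuous_subtype_val)) ‖A.1.2‖ fun x => by
      simpa [SymmForm.eval] using norm_apply_const_le A.1.2 (mem_ball_zero_iff.1 x.2).le

theorem SymmForm.toBallFun_mem_Au (A : SymmForm X) : A.toBallFun ∈ Au X := by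
  refine ⟨A.isHolo_eval, ?_⟩
  change UniformContinuous A.eval
  refine (LipschitzWith.of_dist_le_mul (K := ⟨‖A.1.2‖ * A.1.1, by positivity⟩)
    fun x y => ?_).uniformContinuous
  have h1 := A.1.2.norm_image_sub_le (fun _ => (x : X)) (fun _ => (y : X))
  -- Only an inequality, since for degree `0` the constant tuple is empty and has norm `0`.
  have hc : ∀ v : X, ‖(fun _ : Fin A.1.1 => v)‖ ≤ ‖v‖ := fun v => pi_norm_const_le v
  have h2 : max ‖(fun _ : Fin A.1.1 => (x : X))‖ ‖(fun _ : Fin A.1.1 => (y : X))‖ ^ (A.1.1 - 1)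
      ≤ 1 := by
    refine pow_le_one₀ (le_max_of_le_left (norm_nonneg _)) (max_le ?_ ?_)
    · exact (hc _).trans (mem_ball_zero_iff.1 x.2).le
    · exact (hc _).trans (mem_ball_zero_iff.1 y.2).le
  rw [Fintype.card_fin] at h1
  rw [dist_eq_norm, Subtype.dist_eq, dist_eq_norm]
  refine h1.trans ?_
  calc _ ≤ ‖A.1.2‖ * A.1.1 * 1 * ‖(x : X) - y‖ := by
        gcongr
        exact hc ((x : X) - y)
    _ = _ := by rw [mul_one]; rfl

end PolyFilter

/-! ### Limits under uniform approximation -/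

section Limits

/-- Limits may be interchanged with uniform approximation. -/
theorem tendsto_of_forall_norm_sub_le {α : Type*} {l : Filter α} {f : α → ℂ} {q : ℕ → α → ℂ}
    {a : ℕ → ℂ} {c : ℂ} {ε : ℕ → ℝ} (hε : Tendsto ε atTop (𝓝 0))
    (hfq : ∀ n, ∀ᶠ x in l, ‖f x - q n x‖ ≤ ε n) (hq : ∀ n, Tendsto (q n) l (𝓝 (a n)))
    (ha : Tendsto a atTop (𝓝 c)) : Tendsto f l (𝓝 c) := by
  rw [Metric.tendsto_nhds]
  intro δ hδ
  obtain ⟨n, hn1, hn2⟩ := ((hε.eventually (gt_mem_nhds (show 0 < δ / 3 by positivity))).and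
    (Metric.tendsto_nhds.1 ha (δ / 3) (by positivity))).exists
  filter_upwards [hfq n, Metric.tendsto_nhds.1 (hq n) (δ / 3) (by positivity)] with x hx1 hx2
  rw [← dist_eq_norm] at hx1
  have h1 := dist_triangle4 (f x) (q n x) (a n) c
  linarith

end Limits

/-! ### Taylor series and the Aron-Berner extension on `A_u(B)` -/

section Taylor

variable {X : Type*} [NormedAddCommGroup X] [NormedSpace ℂ X]

/-- Both sides are `m!` times the `m`-th term at `x` of a power series of `F`, since restricting to
a line composes the series with a linear map. -/
theorem iteratedDeriv_comp_smul_zero {F : X → ℂ} (hF : AnalyticAt ℂ F 0) (x : X) (m : ℕ) :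
    iteratedDeriv m (fun t : ℂ => F (t • x)) 0 = iteratedFDeriv ℂ m F 0 fun _ => x := by
  obtain ⟨p, r, hp⟩ := hF
  let u : ℂ →L[ℂ] X := ContinuousLinearMap.toSpanSingleton ℂ x
  have hp' : HasFPowerSeriesOnBall F p (u 0) r := by rwa [map_zero]
  have h1 := hp.factorial_smul x m
  have h2 := hp'.compContinuousLinearMap.factorial_smul (1 : ℂ) m
  have h3 : (F ∘ u) = fun t : ℂ => F (t • x) := rfl
  rw [h3] at h2
  rw [iteratedDeriv_eq_iteratedFDeriv, ← h2, ← h1, FormalMultilinearSeries.compContinuousLinearMap_apply]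
  congr 2
  funext i
  simp [u]

/-- The `m`-th Taylor form at `0`. -/
noncomputable def taylorForm (g : ball (0 : X) 1 → ℂ) (m : ℕ) :
    ContinuousMultilinearMap ℂ (fun _ : Fin m => X) ℂ :=
  (m.factorial : ℂ)⁻¹ • iteratedFDeriv ℂ m (zeroExt g) 0

theorem IsHolo.isSymmForm_taylorForm {g : ball (0 : X) 1 → ℂ} (hg : IsHolo g) (m : ℕ) :
    IsSymmForm (taylorForm g m) := by
  intro σ v
  have h : ContDiffAt ℂ ⊤ (zeroExt g) 0 := (hg 0 (mem_ball_self one_pos)).contDiffAt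
  rw [taylorForm, smul_apply, smul_apply, h.iteratedFDeriv_comp_perm]

/-- The Taylor polynomials at `0`. -/
noncomputable def IsHolo.taylorPoly {g : ball (0 : X) 1 → ℂ} (hg : IsHolo g) (M : ℕ) :
    ContPoly X where
  degree := M
  form := taylorForm g
  symm m := hg.isSymmForm_taylorForm m

theorem smul_mem_unitBall {x : X} (hx : x ∈ ball (0 : X) 1) {t : ℂ} (ht : ‖t‖ ≤ 1) :
    t • x ∈ ball (0 : X) 1 := by
  rw [mem_ball_zero_iff, norm_smul]
  exact (mul_le_of_le_one_left (norm_nonneg _) ht).trans_lt (mem_ball_zero_iff.1 hx)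

theorem IsHolo.differentiableOn_slice {g : ball (0 : X) 1 → ℂ} (hg : IsHolo g) {x : X}
    (hx : x ∈ ball (0 : X) 1) :
    DifferentiableOn ℂ (fun t : ℂ => zeroExt g (t • x)) (closedBall 0 1) := by
  intro t ht
  have h1 := (hg (t • x) (smul_mem_unitBall hx (mem_closedBall_zero_iff.1 ht))).differentiableAt
  exact (h1.comp t (differentiableAt_id.smul_const x)).differentiableWithinAt

theorem taylorForm_apply_const {g : ball (0 : X) 1 → ℂ} (hg : IsHolo g) (x : X) (m : ℕ) :
    (taylorForm g m fun _ => x) =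
      (m.factorial : ℂ)⁻¹ * iteratedDeriv m (fun t : ℂ => zeroExt g (t • x)) 0 := by
  rw [iteratedDeriv_comp_smul_zero (hg 0 (mem_ball_self one_pos)), taylorForm, smul_apply,
    smul_eq_mul]

/-- Cauchy's estimate. -/
theorem norm_taylorForm_apply_const_le {g : BallFun X} (hg : IsHolo g) {x : X}
    (hx : x ∈ ball (0 : X) 1) (m : ℕ) : ‖taylorForm g m fun _ => x‖ ≤ ‖g‖ := by
  have h1 : DiffContOnCl ℂ (fun t : ℂ => zeroExt g (t • x)) (ball 0 1) := by
    refine DifferentiableOn.diffContOnCl ?_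
    rw [closure_ball _ one_ne_zero]
    exact hg.differentiableOn_slice hx
  have h2 := Complex.norm_iteratedDeriv_le_of_forall_mem_sphere_norm_le m one_pos h1
    (C := ‖g‖) fun t ht => by
      have ht' := smul_mem_unitBall hx (mem_sphere_zero_iff_norm.1 ht).le
      rw [zeroExt_apply _ ht']
      exact g.norm_coe_le_norm _
  rw [one_pow, div_one] at h2
  rw [taylorForm_apply_const hg, norm_mul, norm_inv, Complex.norm_natCast,
    inv_mul_le_iff₀ (by positivity)]
  exact h2

/-- On the slice `t ↦ t • x` Cauchy's estimate bounds the `m`-th term by `‖g‖ ‖t‖ ^ m`, so the tail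
is geometric, uniformly in `x`. -/
theorem IsHolo.norm_sub_taylorPoly_le {g : BallFun X} (hg : IsHolo g) {x : X}
    (hx : x ∈ ball (0 : X) 1) {t : ℂ} (ht : ‖t‖ < 1) (M : ℕ) :
    ‖zeroExt g (t • x) - ((hg.taylorPoly M).scale t).eval x‖ ≤
      ‖g‖ * ‖t‖ ^ (M + 1) / (1 - ‖t‖) := by
  have h1 := Complex.hasSum_taylorSeries_on_ball
    ((hg.differentiableOn_slice hx).mono ball_subset_closedBall) (mem_ball_zero_iff.2 ht)
  have h2 : HasSum (fun m : ℕ => t ^ m * taylorForm g m fun _ => x) (zeroExt g (t • x)) := by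
    refine h1.congr_fun fun m => ?_
    rw [taylorForm_apply_const hg, sub_zero, smul_eq_mul, smul_eq_mul]
    ring
  have h3 := norm_sub_le_of_geometric_bound_of_hasSum (r := ‖t‖) (C := ‖g‖) ht (fun m => by
    rw [norm_mul, norm_pow, mul_comm]
    gcongr
    exact norm_taylorForm_apply_const_le hg hx m) h2 (M + 1)
  rw [norm_sub_rev]
  exact h3

theorem norm_smul_bidual (c : ℂ) (w : Bidual X) : ‖c • w‖ = ‖c‖ * ‖w‖ := by
  have h : ∀ (E : Type _) [NormedAddCommGroup E] [NormedSpace ℂ E] (v : E),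
      ‖c • v‖ = ‖c‖ * ‖v‖ := fun E _ _ v => norm_smul c v
  exact h (Bidual X) w

theorem mem_ball_bidual {w : Bidual X} {r : ℝ} : w ∈ ball (0 : Bidual X) r ↔ ‖w‖ < r := by
  have h := mem_ball_zero_iff (E := Bidual X) (a := w) (r := r)
  exact h

theorem mem_closure_ball_bidual {w : Bidual X} (hw : ‖w‖ ≤ 1) :
    w ∈ closure (ball (0 : Bidual X) 1) := by
  have h : ∀ (E : Type _) [NormedAddCommGroup E] [NormedSpace ℂ E] (v : E), ‖v‖ ≤ 1 →
      v ∈ closure (ball (0 : E) 1) := fun E _ _ v hv => by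
    rw [closure_ball _ one_ne_zero]
    exact mem_closedBall_zero_iff.2 hv
  exact h (Bidual X) w hw

theorem summable_aronBernerOpen {g : BallFun X} (hg : IsHolo g) {w : Bidual X} (hw : ‖w‖ < 1) :
    Summable fun m : ℕ => arensExt m (fun _ => w) (taylorForm g m) := by
  obtain ⟨ρ, hwρ, hρ⟩ := exists_between hw
  have hρ0 : 0 < ρ := (norm_nonneg w).trans_lt hwρ
  have hu : ‖((ρ : ℂ)⁻¹ • w)‖ ≤ 1 := by
    rw [norm_smul_bidual, norm_inv, Complex.norm_real, Real.norm_of_nonneg hρ0.le,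
      inv_mul_le_iff₀ hρ0, mul_one]
    exact hwρ.le
  -- Dilating to a point still in the closed ball makes homogeneity supply the geometric factor `ρ ^
  -- m`.
  have hwu : w = (ρ : ℂ) • ((ρ : ℂ)⁻¹ • w) := by
    rw [smul_inv_smul₀ (by exact_mod_cast hρ0.ne')]
  refine Summable.of_norm_bounded ((summable_geometric_of_lt_one hρ0.le hρ).mul_right ‖g‖)
    fun m => ?_
  have h := SymmForm.norm_ext_le (A := ⟨⟨m, taylorForm g m⟩, hg.isSymmForm_taylorForm m⟩)
    (fun x => norm_taylorForm_apply_const_le hg x.2 m) hu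
  rw [hwu, arensExt_const_smul, norm_mul, norm_pow, Complex.norm_real, Real.norm_of_nonneg hρ0.le]
  gcongr
  exact h

theorem tendsto_taylorPoly_aronBerner {g : BallFun X} (hg : IsHolo g) {w : Bidual X}
    (hw : ‖w‖ < 1) :
    Tendsto (fun M => (hg.taylorPoly M).aronBerner w) atTop (𝓝 (aronBernerOpen g w)) := by
  have h1 := (summable_aronBernerOpen hg hw).hasSum.tendsto_sum_nat.comp (tendsto_add_atTop_nat 1)
  have h2 : aronBernerOpen g w = ∑' m : ℕ, arensExt m (fun _ => w) (taylorForm g m) := by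
    refine tsum_congr fun m => ?_
    rw [taylorForm, map_smul, smul_eq_mul]
  rw [h2]
  exact h1

/-- As `x` tends to `w / ρ` in the polynomial-star topology, `g (ρ x)` tends to the extension at
`w`, because the Taylor polynomials converge uniformly on the dilated ball; the bound passes to the
limit. -/
theorem norm_aronBernerOpen_sub_le {g : BallFun X} (hg : IsHolo g) {Q : ContPoly X} {ε : ℝ}
    (hQ : ∀ x : ball (0 : X) 1, ‖g x - Q.eval x‖ ≤ ε) {w : Bidual X} (hw : ‖w‖ < 1) :
    ‖aronBernerOpen g w - Q.aronBerner w‖ ≤ ε := by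
  obtain ⟨ρ, hwρ, hρ⟩ := exists_between hw
  have hρ0 : 0 < ρ := (norm_nonneg w).trans_lt hwρ
  have hρn : ‖(ρ : ℂ)‖ = ρ := by rw [Complex.norm_real, Real.norm_of_nonneg hρ0.le]
  have hu : ‖((ρ : ℂ)⁻¹ • w)‖ ≤ 1 := by
    rw [norm_smul_bidual, norm_inv, hρn, inv_mul_le_iff₀ hρ0, mul_one]
    exact hwρ.le
  have hwu : (ρ : ℂ) • ((ρ : ℂ)⁻¹ • w) = w := smul_inv_smul₀ (by exact_mod_cast hρ0.ne') w
  have hne := polyNhds_neBot hu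
  have h0 : Tendsto (fun M : ℕ => ‖g‖ * ‖(ρ : ℂ)‖ ^ (M + 1) / (1 - ‖(ρ : ℂ)‖)) atTop (𝓝 0) := by
    rw [hρn]
    have := (tendsto_pow_atTop_nhds_zero_of_lt_one hρ0.le hρ).comp (tendsto_add_atTop_nat 1)
    simpa using (this.const_mul ‖g‖).div_const (1 - ρ)
  have h1 : Tendsto (fun x : ball (0 : X) 1 => zeroExt g ((ρ : ℂ) • (x : X)))
      (polyNhds ((ρ : ℂ)⁻¹ • w)) (𝓝 (aronBernerOpen g w)) := by
    refine tendsto_of_forall_norm_sub_le h0 (fun M => Eventually.of_forall fun x =>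
      hg.norm_sub_taylorPoly_le x.2 (hρn.trans_lt hρ) M) (fun M => tendsto_contPoly_eval _ _) ?_
    simp only [ContPoly.aronBerner_scale, hwu]
    exact tendsto_taylorPoly_aronBerner hg hw
  have h2 := tendsto_contPoly_eval (Q.scale ρ) ((ρ : ℂ)⁻¹ • w)
  rw [ContPoly.aronBerner_scale, hwu] at h2
  refine le_of_tendsto (h1.sub h2).norm (Eventually.of_forall fun x => ?_)
  have hx := smul_mem_unitBall x.2 (t := ρ) (hρn.trans_le hρ.le)
  rw [zeroExt_apply _ hx, ContPoly.eval_scale]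
  exact hQ ⟨_, hx⟩

/-- Uniform continuity makes `g` close to its dilation `g (ρ ·)`, whose Taylor polynomials converge
uniformly on the ball. -/
theorem exists_contPoly_norm_sub_le {g : BallFun X} (hg : g ∈ Au X) {ε : ℝ} (hε : 0 < ε) :
    ∃ Q : ContPoly X, ∀ x : ball (0 : X) 1, ‖g x - Q.eval x‖ ≤ ε := by
  have hol : IsHolo g := hg.1
  obtain ⟨δ, hδ, hgδ⟩ := Metric.uniformContinuous_iff.1 hg.2 (ε / 2) (by positivity)
  -- With `ρ > 1 - δ`, the dilation moves points of the ball by less than `δ`.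
  obtain ⟨ρ, hρδ, hρ⟩ := exists_between (max_lt (show (0 : ℝ) < 1 by norm_num)
    (show 1 - δ < 1 by linarith))
  have hρ0 : 0 < ρ := (le_max_left _ _).trans_lt hρδ
  have hρn : ‖(ρ : ℂ)‖ = ρ := by rw [Complex.norm_real, Real.norm_of_nonneg hρ0.le]
  have h0 : Tendsto (fun M : ℕ => ‖g‖ * ‖(ρ : ℂ)‖ ^ (M + 1) / (1 - ‖(ρ : ℂ)‖)) atTop (𝓝 0) := by
    rw [hρn]
    have := (tendsto_pow_atTop_nhds_zero_of_lt_one hρ0.le hρ).comp (tendsto_add_atTop_nat 1)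
    simpa using (this.const_mul ‖g‖).div_const (1 - ρ)
  obtain ⟨M, hM⟩ := (h0.eventually (gt_mem_nhds (show 0 < ε / 2 by positivity))).exists
  refine ⟨(hol.taylorPoly M).scale ρ, fun x => ?_⟩
  have hx := smul_mem_unitBall x.2 (t := ρ) (hρn.trans_le hρ.le)
  have h1 := hol.norm_sub_taylorPoly_le x.2 (hρn.trans_lt hρ) M
  rw [zeroExt_apply _ hx] at h1
  have h2 : dist x ⟨(ρ : ℂ) • (x : X), hx⟩ < δ := by
    rw [Subtype.dist_eq, dist_eq_norm]
    have h3 : (x : X) - (ρ : ℂ) • (x : X) = ((1 - ρ : ℝ) : ℂ) • (x : X) := by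
      push_cast
      rw [sub_smul, one_smul]
    rw [h3, norm_smul, Complex.norm_real, Real.norm_of_nonneg (by linarith)]
    have h4 := mem_ball_zero_iff.1 x.2
    have h5 := (le_max_right _ _).trans_lt hρδ
    nlinarith [norm_nonneg (x : X)]
  have h3 := hgδ h2
  rw [dist_eq_norm] at h3
  have h4 := norm_sub_le_norm_sub_add_norm_sub (g x) (g ⟨(ρ : ℂ) • (x : X), hx⟩)
    (((hol.taylorPoly M).scale ρ).eval x)
  linarith

/-- The values of `g ∈ A_u(B)` converge to the Aron-Berner extension along every filter converging
to `z` in the polynomial-star topology. -/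
theorem tendsto_aronBerner {g : BallFun X} (hg : g ∈ Au X) {z : Bidual X} (hz : ‖z‖ ≤ 1)
    {l : Filter (ball (0 : X) 1)}
    (hl : ∀ P : ContPoly X, Tendsto (fun x : ball (0 : X) 1 => P.eval x) l (𝓝 (P.aronBerner z))) :
    Tendsto g l (𝓝 (aronBerner g z)) := by
  choose Q hQ using fun n : ℕ => exists_contPoly_norm_sub_le hg
    (show (0 : ℝ) < 1 / ((n : ℝ) + 1) by positivity)
  have hε := tendsto_one_div_add_atTop_nhds_zero_nat (𝕜 := ℝ)
  -- The Davie-Gamelin inequality transfers uniform closeness of the `Q n` on the ball to their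
  -- extensions at `z`.
  have hcau : CauchySeq fun n => (Q n).aronBerner z := by
    refine cauchySeq_of_le_tendsto_0 (fun n : ℕ => 2 * (1 / ((n : ℝ) + 1))) (fun n m N hn hm => ?_)
      (by simpa using hε.const_mul 2)
    rw [dist_eq_norm]
    refine ContPoly.norm_aronBerner_sub_le (fun x => ?_) hz
    have h1 := hQ n x
    have h2 := hQ m x
    have h3 : 1 / ((n : ℝ) + 1) ≤ 1 / ((N : ℝ) + 1) := by gcongr
    have h4 : 1 / ((m : ℝ) + 1) ≤ 1 / ((N : ℝ) + 1) := by gcongr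
    have h5 := norm_sub_le_norm_sub_add_norm_sub ((Q n).eval x) (g x) ((Q m).eval x)
    rw [norm_sub_rev] at h1
    linarith
  obtain ⟨c, hc⟩ := cauchySeq_tendsto_of_complete hcau
  -- The same polynomials approximate the extension on the open bidual ball, so its norm limit at
  -- `z` exists and is `c`.
  have hval : aronBerner g z = c := extendFrom_eq (mem_closure_ball_bidual hz) <|
    tendsto_of_forall_norm_sub_le hε (fun n => eventually_nhdsWithin_of_forall fun w hw =>
      norm_aronBernerOpen_sub_le hg.1 (hQ n) (mem_ball_bidual.1 hw))
      (fun n => (Q n).continuous_aronBerner.continuousAt.continuousWithinAt) hc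
  rw [hval]
  exact tendsto_of_forall_norm_sub_le hε (fun n => Eventually.of_forall (hQ n))
    (fun n => hl (Q n)) hc

/-- Both sides are the limit of the same function along `polyNhds z`. -/
theorem aronBerner_toBallFun (A : SymmForm X) {z : Bidual X} (hz : ‖z‖ ≤ 1) :
    aronBerner A.toBallFun z = A.ext z :=
  have := polyNhds_neBot hz
  tendsto_nhds_unique
    (tendsto_aronBerner A.toBallFun_mem_Au hz fun P => tendsto_contPoly_eval P z)
    (tendsto_symmForm_eval A z)

end Taylor

/-! ### Characters from ultrafilters -/

section Characters

theorem BallFun.exists_tendsto_ultrafilter {X : Type*} [NormedAddCommGroup X]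
    (U : Ultrafilter (ball (0 : X) 1)) (f : BallFun X) :
    ∃ c, Tendsto f U (𝓝 c) := by
  obtain ⟨c, -, hc⟩ := (isCompact_closedBall (0 : ℂ) ‖f‖).ultrafilter_le_nhds (U.map f) (by
    rw [le_principal_iff]
    exact (Eventually.of_forall fun x => mem_closedBall_zero_iff.2 (f.norm_coe_le_norm x) :
      ∀ᶠ x in (U : Filter (ball (0 : X) 1)), f x ∈ closedBall (0 : ℂ) ‖f‖))
  exact ⟨c, hc⟩

variable {X : Type*} [NormedAddCommGroup X] [NormedSpace ℂ X]

/-- The limit of bounded functions along an ultrafilter. -/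
noncomputable def ultralimit (U : Ultrafilter (ball (0 : X) 1)) : BallFun X →ₐ[ℂ] ℂ :=
  have h := fun f => (BallFun.exists_tendsto_ultrafilter U f).choose_spec
  AlgHom.ofLinearMap
    { toFun := fun f => (BallFun.exists_tendsto_ultrafilter U f).choose
      map_add' := fun f g => tendsto_nhds_unique (h (f + g)) ((h f).add (h g))
      map_smul' := fun c f => tendsto_nhds_unique (h (c • f)) ((h f).const_smul c) }
    (tendsto_nhds_unique (h 1) tendsto_const_nhds)
    (fun f g => tendsto_nhds_unique (h (f * g)) ((h f).mul (h g)))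

theorem tendsto_ultralimit (U : Ultrafilter (ball (0 : X) 1)) (f : BallFun X) :
    Tendsto f U (𝓝 (ultralimit U f)) :=
  (BallFun.exists_tendsto_ultrafilter U f).choose_spec

end Characters

/-! ### Cluster values, the fiber and finite sets of forms -/

section Spectrum

variable {X : Type*} [NormedAddCommGroup X] [NormedSpace ℂ X]

/-- Every cluster value is attained by a character in the polynomial fiber. -/
theorem clusterSet_subset_image_polyFiber {H : Subalgebra ℂ (BallFun X)}
    (hclosed : IsClosed (H : Set (BallFun X))) (hAu : Au X ≤ H) {z : Bidual X} (hz : ‖z‖ ≤ 1)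
    (f : H) :
    clusterSet (f : BallFun X) z ⊆ (WeakDual.gelfandTransform ℂ H f) '' polyFiber hAu z := by
  rintro c ⟨l, hl, hlP, hlf⟩
  -- Completeness makes every unital algebra homomorphism to `ℂ` continuous, so the ultrafilter
  -- limit is a point of the spectrum.
  have hcomplete : CompleteSpace H := hclosed.completeSpace_coe
  let U := Ultrafilter.of l
  have hU : (U : Filter (ball (0 : X) 1)) ≤ l := Ultrafilter.of_le l
  refine ⟨WeakDual.CharacterSpace.equivAlgHom.symm ((ultralimit U).comp H.val), fun g hg => ?_, ?_⟩
  · exact tendsto_nhds_unique (tendsto_ultralimit U g)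
      ((tendsto_aronBerner hg hz hlP).mono_left hU)
  · exact tendsto_nhds_unique (tendsto_ultralimit U f) (hlf.mono_left hU)

/-- If the polynomial-star neighbourhoods of `z` met every set on which `f` is near `c`, their
infimum would be a filter witnessing `c` as a cluster value. So two basic sets are disjoint, and one
of them involves only finitely many forms. -/
theorem exists_forms_of_notMem_clusterSet {f : ball (0 : X) 1 → ℂ} {z : Bidual X} {c : ℂ}
    (hc : c ∉ clusterSet f z) :
    ∃ (I : Finset (SymmForm X)) (δ : ℝ), 0 < δ ∧ ∀ x : ball (0 : X) 1,
      δ ≤ (∑ A ∈ I, ‖A.eval x - A.ext z‖) + ‖f x - c‖ := by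
  have h : polyNhds z ⊓ comap f (𝓝 c) = ⊥ := by
    by_contra hne
    exact hc ⟨_, neBot_iff.2 hne, fun P => (tendsto_contPoly_eval P z).mono_left inf_le_left,
      tendsto_comap.mono_left inf_le_right⟩
  obtain ⟨s, hs, t, ht, hst⟩ := Filter.inf_eq_bot_iff.1 h
  obtain ⟨s', hs', hss'⟩ := mem_comap.1 hs
  obtain ⟨t', ht', htt'⟩ := mem_comap.1 ht
  obtain ⟨I, ε, hε, hI⟩ := exists_finset_of_mem_nhds_pi hs'
  obtain ⟨r, hr, hrt⟩ := Metric.mem_nhds_iff.1 ht'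
  refine ⟨I, min ε r, lt_min hε hr, fun x => ?_⟩
  by_contra! hlt
  have hsum : 0 ≤ ∑ A ∈ I, ‖A.eval x - A.ext z‖ := Finset.sum_nonneg fun A _ => norm_nonneg _
  have hx1 : x ∈ s := hss' <| hI _ fun A hA => by
    have h1 := Finset.single_le_sum (f := fun A : SymmForm X => ‖A.eval x - A.ext z‖)
      (fun A _ => norm_nonneg _) hA
    have h2 := norm_nonneg (f x - c)
    have h3 := min_le_left ε r
    linarith
  have hx2 : x ∈ t := htt' <| hrt <| by
    rw [mem_ball, dist_eq_norm]
    have h3 := min_le_right ε r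
    linarith
  exact (Set.eq_empty_iff_forall_notMem.1 hst) x ⟨hx1, hx2⟩

end Spectrum

end PolyCluster

open PolyCluster

/-! ### The equivalence -/

theorem theorem2p6 {X : Type*} [NormedAddCommGroup X] [NormedSpace ℂ X] [CompleteSpace X]
    (H : Subalgebra ℂ (PolyCluster.BallFun X))
    (hclosed : IsClosed (H : Set (PolyCluster.BallFun X)))
    (hAu : PolyCluster.Au X ≤ H) (hHInf : H ≤ PolyCluster.HInf X)
    (z : PolyCluster.Bidual X) (hz : ‖z‖ ≤ 1) :
    PolyCluster.PolyClusterValueTheorem hAu z ↔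
      ∀ (m : ℕ) (f : Fin m → H) (g : H),
        (∀ j, (f j : PolyCluster.BallFun X) ∈ PolyCluster.Au X) →
        (∃ δ : ℝ, 0 < δ ∧ ∀ x : Metric.ball (0 : X) 1,
          δ ≤ (∑ j, ‖(f j : PolyCluster.BallFun X) x‖) + ‖(g : PolyCluster.BallFun X) x‖) →
        ¬ ∃ τ ∈ PolyCluster.polyFiber hAu z,
          (∀ j, WeakDual.gelfandTransform ℂ H (f j) τ = 0) ∧
            WeakDual.gelfandTransform ℂ H g τ = 0 := by
  constructor
  · rintro hcv m f g hf ⟨δ, hδ, hfg⟩ ⟨τ, hτ, hτf, hτg⟩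
    have h0 : (0 : ℂ) ∈ clusterSet (g : BallFun X) z := by
      rw [hcv g]
      exact ⟨τ, hτ, hτg⟩
    obtain ⟨l, hl, hlP, hlg⟩ := h0
    have hlf : ∀ j, Tendsto (f j : BallFun X) l (𝓝 0) := fun j => by
      have h1 := tendsto_aronBerner (hf j) hz hlP
      rw [← hτ _ (hf j)] at h1
      exact (hτf j) ▸ h1
    have hsum : Tendsto (fun x => (∑ j, ‖(f j : BallFun X) x‖) + ‖(g : BallFun X) x‖) l (𝓝 0) := by
      have := (tendsto_finsetSum Finset.univ fun j _ => (hlf j).norm).add hlg.norm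
      simpa using this
    exact absurd (ge_of_tendsto' hsum hfg) (not_le.2 hδ)
  · intro hcor f
    refine (clusterSet_subset_image_polyFiber hclosed hAu hz f).antisymm ?_
    rintro _ ⟨τ, hτ, rfl⟩
    by_contra hc
    obtain ⟨I, δ, hδ, hI⟩ := exists_forms_of_notMem_clusterSet hc
    have hA : ∀ A : SymmForm X, A.toBallFun - algebraMap ℂ (BallFun X) (A.ext z) ∈ Au X :=
      fun A => sub_mem A.toBallFun_mem_Au (algebraMap_mem _ _)
    -- Subtracting the value at `z` puts each form in the kernel of `τ`, as `τ` agrees with the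
    -- Aron-Berner evaluation on `A_u(B)`.
    let F : SymmForm X → H := fun A => ⟨_, hAu A.toBallFun_mem_Au⟩ - algebraMap ℂ H (A.ext z)
    refine hcor I.card (fun j => F (I.equivFin.symm j))
      (f - algebraMap ℂ H (WeakDual.gelfandTransform ℂ H f τ)) (fun j => hA _)
      ⟨δ, hδ, fun x => (hI x).trans_eq ?_⟩ ⟨τ, hτ, fun j => ?_, ?_⟩
    · congr 1
      rw [← Finset.sum_coe_sort I, ← I.equivFin.symm.sum_comp]
      rfl
    · have h1 := hτ _ (I.equivFin.symm j).1.toBallFun_mem_Au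
      rw [aronBerner_toBallFun _ hz] at h1
      change τ (F (I.equivFin.symm j)) = 0
      rw [map_sub, h1, AlgHomClass.commutes]
      exact sub_self _
    · change τ (f - algebraMap ℂ H (τ f)) = 0
      rw [map_sub, AlgHomClass.commutes]
      exact sub_self _
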